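/- An orthogonality relation on a set $X$ is a symmetric relation $\perp$ on subsets of $X$ such that $\emptyset\perp X$, and $A\perp (C\cup C')$ if and only if $A\perp C$ and $A\perp C'$. A subset $B\subseteq X$ is $\perp$-bounded if $B\perp X$. The relation $\perp$ is normal if 1. $\{x\}\perp\{y\}$ whenever $x\ne y$; 2. whenever $C\perp D$, there are sets $C',D'$ with $X=C'\cup D'$, $C'\perp D$ and $D'\perp C$; 3. $B\perp B$ implies that $B$ is $\perp$-bounded. A bornology is a family of subsets closed under finite unions (in particular containing $\emptyset$) and under passing to subsets; it need not cover the space. A large scale topological space is a topological space with a selected bornology $\mathcal B$ of open-closed subsets. It is large scale compact if every open cover $\{U_s\}_{s\in S}$ of it has a finite subfamily $\{U_s\}_{s\in F}$ such that the complement of $\bigcup_{s\in F}U_s$ belongs to $\mathcal B$. A Hausdorff large scale compactification of $(X,\perp)$ is a Hausdorff large scale compact space $\bar X$ containing $X$ as a dense subset such that 1. the selected bornology of $\bar X$ consists exactly of the $\perp$-bounded subsets of $X$; 2. two subsets $C,D$ of $X$ satisfy $C\perp D$ if and only if the intersection of their closures in $\bar X$ is contained in $X$ and is $\perp$-bounded.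 **Corollary 13.15.** If $\perp$ is a normal orthogonality relation on a set $X$, then $(X,\perp)$ has a Hausdorff large scale compactification, and it is unique up to homeomorphism fixing $X$: for any two Hausdorff large scale compactifications $\bar X_1,\bar X_2$ of $(X,\perp)$ there is a homeomorphism $h:\bar X_1\to\bar X_2$ with $h(x)=x$ for all $x\in X$. -/

import Mathlib

universe u v w

/-- An orthogonality relation on the subsets of a set `X`: a symmetric relation with `∅ ⊥ X` and
`A ⊥ (C ∪ C')` iff `A ⊥ C` and `A ⊥ C'`. -/
structure OrthogonalityRelation (X : Type u) where
  /-- `orth A C` is `A ⊥ C`. -/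
  orth : Set X → Set X → Prop
  symm : ∀ A C : Set X, orth A C → orth C A
  empty_univ : orth ∅ Set.univ
  union_iff : ∀ A C C' : Set X, orth A (C ∪ C') ↔ orth A C ∧ orth A C'

namespace OrthogonalityRelation

variable {X : Type u} (P : OrthogonalityRelation X)

/-- `B` is bounded if it is orthogonal to the whole set. -/
def IsBounded (B : Set X) : Prop := P.orth B Set.univ

/-- `C` and `D` span `X`: `C ⊥ D` and `X = C' ∪ D'` with `C' ⊥ D` and `D' ⊥ C`. -/
def Spans (C D : Set X) : Prop :=
  P.orth C D ∧ ∃ C' D' : Set X, C' ∪ D' = Set.univ ∧ P.orth C' D ∧ P.orth D' C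

/-- Distinct points are orthogonal. -/
def IsFrechet : Prop := ∀ x y : X, x ≠ y → P.orth {x} {y}

/-- Normal orthogonality relations. -/
structure IsNormal : Prop where
  frechet : P.IsFrechet
  spans : ∀ C D : Set X, P.orth C D → P.Spans C D
  bounded_of_self : ∀ B : Set X, P.orth B B → P.IsBounded B

end OrthogonalityRelation

/-- A large scale structure on a topological space: a selected bornology consisting of open-closed
subsets. Here a bornology is a family of subsets closed under finite unions and under passing to
subsets; it need not cover the space, so this is not Mathlib's `Bornology`. -/
structure LargeScaleStructure (Y : Type v) [TopologicalSpace Y] where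
  bornology : Set (Set Y)
  empty_mem : ∅ ∈ bornology
  union_mem : ∀ A ∈ bornology, ∀ B ∈ bornology, A ∪ B ∈ bornology
  subset_mem : ∀ B ∈ bornology, ∀ A : Set Y, A ⊆ B → A ∈ bornology
  isClopen : ∀ B ∈ bornology, IsClopen B

/-- Large scale compactness: every open cover has a finite subfamily whose union has a complement
in the selected bornology. -/
def LargeScaleStructure.IsLargeScaleCompact {Y : Type v} [TopologicalSpace Y]
    (L : LargeScaleStructure Y) : Prop :=
  ∀ 𝒰 : Set (Set Y), (∀ U ∈ 𝒰, IsOpen U) → ⋃₀ 𝒰 = Set.univ →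
    ∃ ℱ : Set (Set Y), ℱ ⊆ 𝒰 ∧ ℱ.Finite ∧ (⋃₀ ℱ)ᶜ ∈ L.bornology

/-- The large scale topological space `(Y, L)` together with the inclusion `ι : X → Y` is a
large scale compactification of `(X, ⊥)`. -/
structure IsLargeScaleCompactification {X : Type u} (P : OrthogonalityRelation X)
    {Y : Type v} [TopologicalSpace Y] (L : LargeScaleStructure Y) (ι : X → Y) : Prop where
  largeScaleCompact : L.IsLargeScaleCompact
  injective : Function.Injective ι
  dense : DenseRange ι
  bornology_eq : L.bornology = {S : Set Y | ∃ B : Set X, P.IsBounded B ∧ ι '' B = S}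
  orth_iff : ∀ C D : Set X, P.orth C D ↔
    closure (ι '' C) ∩ closure (ι '' D) ⊆ Set.range ι ∧
      P.IsBounded (ι ⁻¹' (closure (ι '' C) ∩ closure (ι '' D)))

open Set Filter Topology

/-! ### Orthogonality, farness and near ultrafilters. -/

namespace OrthogonalityRelation

variable {X : Type u} (P : OrthogonalityRelation X)

/-! Existence: adding disjointness to orthogonality gives a separated proximity, and the space is
built from near-classes of ultrafilters. Nonprincipal ultrafilters with a bounded member are
discarded, so bounded sets acquire no new points and become discrete and clopen. Compactness of the
full ultrafilter space then survives up to a bounded set (`isLargeScaleCompact`). Orthogonality is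
recovered from closures by `closure_inter_closure_subset` and, conversely,
`exists_near_of_not_orth`.

Uniqueness: large scale compactness and regularity make one inclusion of `X` converge at every point
of the other compactification (`exists_tendsto`). The continuous extensions in both directions are
mutually inverse by density. -/

variable {P} in
lemma orth_mono_right {A C D : Set X} (h : P.orth A D) (hCD : C ⊆ D) : P.orth A C := by
  rw [← union_eq_self_of_subset_left hCD] at h
  exact ((P.union_iff _ _ _).1 h).1

variable {P} in
lemma orth_mono {A B C D : Set X} (h : P.orth B D) (hAB : A ⊆ B) (hCD : C ⊆ D) : P.orth A C :=
  P.symm _ _ (orth_mono_right (P.symm _ _ (orth_mono_right h hCD)) hAB)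

lemma orth_union_left {A B C : Set X} (hA : P.orth A C) (hB : P.orth B C) : P.orth (A ∪ B) C :=
  P.symm _ _ ((P.union_iff _ _ _).2 ⟨P.symm _ _ hA, P.symm _ _ hB⟩)

lemma orth_empty_left (A : Set X) : P.orth ∅ A := orth_mono P.empty_univ subset_rfl (subset_univ _)

variable {P} in
lemma IsBounded.orth {B : Set X} (h : P.IsBounded B) (A : Set X) : P.orth B A :=
  orth_mono_right h (subset_univ _)

variable {P} in
lemma IsBounded.subset {A B : Set X} (h : P.IsBounded B) (hAB : A ⊆ B) : P.IsBounded A :=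
  orth_mono h hAB subset_rfl

variable {P} in
lemma IsBounded.union {A B : Set X} (hA : P.IsBounded A) (hB : P.IsBounded B) :
    P.IsBounded (A ∪ B) := P.orth_union_left hA hB

lemma isBounded_empty : P.IsBounded ∅ := P.empty_univ

variable {P} in
lemma IsNormal.isBounded_inter (hP : P.IsNormal) {C D : Set X} (h : P.orth C D) :
    P.IsBounded (C ∩ D) :=
  hP.bounded_of_self _ (orth_mono h inter_subset_left inter_subset_right)

/-- Two sets are far if they are disjoint and orthogonal. For a normal orthogonality relation this
is the complement of a separated proximity. -/
def Far (A B : Set X) : Prop := Disjoint A B ∧ P.orth A B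

variable {P}

lemma Far.symm {A B : Set X} (h : P.Far A B) : P.Far B A := ⟨h.1.symm, P.symm _ _ h.2⟩

lemma IsBounded.far_compl {B : Set X} (h : P.IsBounded B) : P.Far B Bᶜ :=
  ⟨disjoint_compl_right, h.orth _⟩

/-- Normality gives a cover without disjointness, but the overlaps `C ∩ B` and `D ∩ A` are bounded,
so exchanging them between the two pieces costs no orthogonality. -/
lemma IsNormal.exists_far (hP : P.IsNormal) {A B : Set X} (h : P.Far A B) :
    ∃ C D : Set X, C ∪ D = univ ∧ P.Far C B ∧ P.Far D A := by
  obtain ⟨hd, ho⟩ := h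
  obtain ⟨-, C, D, hCD, hC, hD⟩ := hP.spans A B ho
  have hb₁ := hP.isBounded_inter hC
  have hb₂ := hP.isBounded_inter hD
  rw [Set.disjoint_left] at hd
  refine ⟨(C \ B) ∪ (D ∩ A), (D \ A) ∪ (C ∩ B), ?_, ⟨?_, ?_⟩, ⟨?_, ?_⟩⟩
  · ext x
    have hx : x ∈ C ∪ D := hCD ▸ mem_univ x
    have := @hd x
    simp only [mem_union, Set.mem_sdiff, mem_inter_iff, mem_univ, iff_true] at hx ⊢
    tauto
  · rw [Set.disjoint_left]
    rintro x (hx | hx) hB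
    exacts [hx.2 hB, hd hx.2 hB]
  · exact P.orth_union_left (orth_mono hC sdiff_subset subset_rfl) (hb₂.orth _)
  · rw [Set.disjoint_left]
    rintro x (hx | hx) hA
    exacts [hx.2 hA, hd hA hx.2]
  · exact P.orth_union_left (orth_mono hD sdiff_subset subset_rfl) (hb₁.orth _)

/-- Two ultrafilters are near if no member of the first is far from a member of the second. -/
def Near (P : OrthogonalityRelation X) (F G : Ultrafilter X) : Prop :=
  ∀ A ∈ F, ∀ B ∈ G, ¬ P.Far A B

/-- A set far from a member of `F` also has a far set in each ultrafilter near `F`. -/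
lemma IsNormal.exists_far_of_near (hP : P.IsNormal) {F G : Ultrafilter X} (h : P.Near F G)
    {A D : Set X} (hA : A ∈ F) (hAD : P.Far A D) : ∃ C ∈ G, P.Far C D := by
  obtain ⟨C, E, hCE, hC, hE⟩ := hP.exists_far hAD
  have hG : C ∪ E ∈ G := hCE ▸ univ_mem
  rcases Ultrafilter.union_mem_iff.1 hG with hG | hG
  · exact ⟨C, hG, hC⟩
  · exact absurd hE.symm (h A hA E hG)

lemma Near.refl (F : Ultrafilter X) : P.Near F F := fun _ hA _ hB h =>
  F.nonempty_of_mem (inter_mem hA hB) |>.ne_empty h.1.inter_eq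

lemma Near.symm {F G : Ultrafilter X} (h : P.Near F G) : P.Near G F :=
  fun _ hA _ hB hAB => h _ hB _ hA hAB.symm

lemma IsNormal.near_trans (hP : P.IsNormal) {F G H : Ultrafilter X} (h : P.Near F G)
    (h' : P.Near G H) : P.Near F H := fun _ hA B hB hAB =>
  let ⟨C, hC, hCB⟩ := hP.exists_far_of_near h hA hAB
  h' C hC B hB hCB

lemma Near.bounded_mem {F G : Ultrafilter X} (h : P.Near F G) {B : Set X} (hB : P.IsBounded B)
    (hF : B ∈ F) : B ∈ G := by
  by_contra hG
  exact h B hF Bᶜ (Ultrafilter.compl_mem_iff_notMem.2 hG) hB.far_compl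

/-- An ultrafilter is admissible if it is principal or contains no bounded set. -/
def Admissible (P : OrthogonalityRelation X) (F : Ultrafilter X) : Prop :=
  ∀ B ∈ F, P.IsBounded B → ∃ x, F = pure x

lemma admissible_pure (x : X) : P.Admissible (pure x) := fun _ _ _ => ⟨x, rfl⟩

/-- Nearness as an equivalence relation on admissible ultrafilters. -/
def nearSetoid (hP : P.IsNormal) : Setoid {F : Ultrafilter X // P.Admissible F} where
  r F G := P.Near F G
  iseqv := ⟨fun F => Near.refl F.1, Near.symm, hP.near_trans⟩

/-- The large scale compactification: admissible ultrafilters modulo nearness. -/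
abbrev LSCompactification (hP : P.IsNormal) : Type u := Quotient (nearSetoid hP)

/-! ### Topology of the space of near-classes. -/

namespace LSCompactification

variable (hP : P.IsNormal)

/-- The class of an admissible ultrafilter. -/
def mk (F : {F : Ultrafilter X // P.Admissible F}) : LSCompactification hP :=
  Quotient.mk (nearSetoid hP) F

/-- The inclusion of `X`, by principal ultrafilters. -/
def of (x : X) : LSCompactification hP := mk hP ⟨pure x, admissible_pure x⟩

lemma mk_eq_iff {F G : {F : Ultrafilter X // P.Admissible F}} :
    mk hP F = mk hP G ↔ P.Near F G := Quotient.eq (r := nearSetoid hP)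

lemma isQuotientMap_mk : IsQuotientMap (mk hP) := isQuotientMap_quot_mk

lemma mk_surjective : Function.Surjective (mk hP) := (isQuotientMap_mk hP).surjective

/-- The classes of ultrafilters with a member far from `D`. -/
def farSet (D : Set X) : Set (LSCompactification hP) := {q | ∃ F, mk hP F = q ∧ ∃ A ∈ F.1, P.Far A D}

lemma mk_mem_farSet {F : {F : Ultrafilter X // P.Admissible F}} {D : Set X} :
    mk hP F ∈ farSet hP D ↔ ∃ A ∈ F.1, P.Far A D := by
  refine ⟨?_, fun h => ⟨F, rfl, h⟩⟩
  rintro ⟨G, hG, A, hA, hAD⟩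
  exact hP.exists_far_of_near ((mk_eq_iff hP).1 hG) hA hAD

lemma isOpen_farSet (D : Set X) : IsOpen (farSet hP D) := by
  rw [← (isQuotientMap_mk hP).isOpen_preimage]
  have : mk hP ⁻¹' farSet hP D =
      Subtype.val ⁻¹' ⋃ A ∈ {A | P.Far A D}, {F : Ultrafilter X | A ∈ F} := by
    ext F
    simp only [mem_preimage, mk_mem_farSet, mem_ofPred_eq, mem_iUnion, exists_prop]
    exact exists_congr fun A => and_comm
  rw [this]
  exact (isOpen_biUnion fun A _ => ultrafilter_isOpen_basic A).preimage continuous_subtype_val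

/-- An ultrafilter in both neighbourhoods would have a member disjoint from `C ∪ D`, which is all of
`X`. -/
instance : T2Space (LSCompactification hP) := by
  refine ⟨fun p q hpq => ?_⟩
  obtain ⟨F, rfl⟩ := mk_surjective hP p
  obtain ⟨G, rfl⟩ := mk_surjective hP q
  rw [Ne, mk_eq_iff, Near] at hpq
  push Not at hpq
  obtain ⟨A, hA, B, hB, hAB⟩ := hpq
  obtain ⟨C, D, hCD, hC, hD⟩ := hP.exists_far hAB
  refine ⟨_, _, isOpen_farSet hP D, isOpen_farSet hP C, (mk_mem_farSet hP).2 ⟨A, hA, hD.symm⟩,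
    (mk_mem_farSet hP).2 ⟨B, hB, hC.symm⟩, Set.disjoint_left.2 fun r hr hr' => ?_⟩
  obtain ⟨H, rfl⟩ := mk_surjective hP r
  obtain ⟨E, hE, hED⟩ := (mk_mem_farSet hP).1 hr
  obtain ⟨E', hE', hEC⟩ := (mk_mem_farSet hP).1 hr'
  obtain ⟨x, hx, hx'⟩ := H.1.nonempty_of_mem (inter_mem hE hE')
  have hx'' : x ∈ C ∪ D := hCD ▸ mem_univ x
  rcases hx'' with h | h
  · exact Set.disjoint_left.1 hEC.1 hx' h
  · exact Set.disjoint_left.1 hED.1 hx h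

lemma of_injective : Function.Injective (of hP) := fun x y h => by
  by_contra hne
  exact (mk_eq_iff hP).1 h {x} (mem_singleton x) {y} (mem_singleton y)
    ⟨disjoint_singleton.2 hne, hP.frechet x y hne⟩

lemma mk_mem_closure {F : {F : Ultrafilter X // P.Admissible F}} {A : Set X} (hA : A ∈ F.1) :
    mk hP F ∈ closure (of hP '' A) := by
  have h : Tendsto (fun x => (⟨pure x, admissible_pure x⟩ : {F : Ultrafilter X // P.Admissible F}))
      F.1 (𝓝 F) := tendsto_subtype_rng.2 F.1.tendsto_pure_self
  have h' : Tendsto (of hP) F.1 (𝓝 (mk hP F)) := ((isQuotientMap_mk hP).continuous.tendsto F).comp h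
  exact mem_closure_of_tendsto h' (mem_of_superset hA fun x hx => mem_image_of_mem _ hx)

lemma not_far_of_mem_closure {F : {F : Ultrafilter X // P.Admissible F}} {D : Set X}
    (h : mk hP F ∈ closure (of hP '' D)) {A : Set X} (hA : A ∈ F.1) : ¬ P.Far A D := fun hAD => by
  obtain ⟨_, hq, x, hx, rfl⟩ := mem_closure_iff.1 h _ (isOpen_farSet hP D)
    ((mk_mem_farSet hP).2 ⟨A, hA, hAD⟩)
  obtain ⟨E, hE, hED⟩ := (mk_mem_farSet hP).1 hq
  exact Set.disjoint_left.1 hED.1 hE hx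

lemma denseRange_of : DenseRange (of hP) := fun q => by
  obtain ⟨F, rfl⟩ := mk_surjective hP q
  rw [← image_univ]
  exact mk_mem_closure hP univ_mem

lemma mk_mem_image_of {F : {F : Ultrafilter X // P.Admissible F}} {B : Set X}
    (hB : P.IsBounded B) : mk hP F ∈ of hP '' B ↔ B ∈ F.1 := by
  constructor
  · rintro ⟨x, hx, h⟩
    exact Near.bounded_mem ((mk_eq_iff hP).1 h) hB hx
  · intro h
    obtain ⟨F, hF⟩ := F
    obtain ⟨x, rfl⟩ := hF B h hB
    exact ⟨x, h, rfl⟩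

lemma isClopen_image_of {B : Set X} (hB : P.IsBounded B) : IsClopen (of hP '' B) := by
  rw [← (isQuotientMap_mk hP).isClopen_preimage]
  have : mk hP ⁻¹' (of hP '' B) = Subtype.val ⁻¹' {F : Ultrafilter X | B ∈ F} := by
    ext F
    exact mk_mem_image_of hP hB
  rw [this]
  exact IsClopen.preimage ⟨ultrafilter_isClosed_basic B, ultrafilter_isOpen_basic B⟩
    continuous_subtype_val

/-- The bornology of images of bounded sets. -/
def largeScaleStructure : LargeScaleStructure (LSCompactification hP) where
  bornology := {S | ∃ B : Set X, P.IsBounded B ∧ of hP '' B = S}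
  empty_mem := ⟨∅, P.isBounded_empty, image_empty _⟩
  union_mem := by
    rintro _ ⟨A, hA, rfl⟩ _ ⟨B, hB, rfl⟩
    exact ⟨A ∪ B, hA.union hB, image_union _ _ _⟩
  subset_mem := by
    rintro _ ⟨B, hB, rfl⟩ S hS
    obtain ⟨A, hA, rfl⟩ := subset_image_iff.1 hS
    exact ⟨A, hB.subset hA, rfl⟩
  isClopen := by
    rintro _ ⟨B, hB, rfl⟩
    exact isClopen_image_of hP hB

lemma isLargeScaleCompact : (largeScaleStructure hP).IsLargeScaleCompact := by
  intro 𝒰 ho hc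
  obtain ⟨ℱ, hℱ, hfin, B, hB, h⟩ : ∃ ℱ ⊆ 𝒰, ℱ.Finite ∧ ∃ B, P.IsBounded B ∧
      ∀ F, F.1 ∈ (univ : Set (Ultrafilter X)) → mk hP F ∈ ⋃₀ ℱ ∨ B ∈ F.1 := by
    refine isCompact_univ.induction_on (p := fun T => ∃ ℱ ⊆ 𝒰, ℱ.Finite ∧ ∃ B, P.IsBounded B ∧
      ∀ F, F.1 ∈ T → mk hP F ∈ ⋃₀ ℱ ∨ B ∈ F.1) ?_ ?_ ?_ ?_
    · exact ⟨∅, empty_subset _, finite_empty, ∅, P.isBounded_empty, fun F hF => hF.elim⟩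
    · rintro S T hST ⟨ℱ, hℱ, hfin, B, hB, h⟩
      exact ⟨ℱ, hℱ, hfin, B, hB, fun F hF => h F (hST hF)⟩
    · rintro S T ⟨ℱ, hℱ, hfin, B, hB, h⟩ ⟨𝒢, h𝒢, hfin', C, hC, h'⟩
      refine ⟨ℱ ∪ 𝒢, union_subset hℱ h𝒢, hfin.union hfin', B ∪ C, hB.union hC, ?_⟩
      rintro F (hF | hF)
      · exact (h F hF).imp (sUnion_mono subset_union_left ·)
          fun h => mem_of_superset h subset_union_left
      · exact (h' F hF).imp (sUnion_mono subset_union_right ·)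
          fun h => mem_of_superset h subset_union_right
    · intro F _
      -- Ultrafilters with a bounded member, including all inadmissible ones, are absorbed into the
      -- exceptional set `B`; only the others need a member of the cover.
      by_cases hF : ∃ B ∈ F, P.IsBounded B
      · obtain ⟨B, hBF, hB⟩ := hF
        exact ⟨{G | B ∈ G}, mem_nhdsWithin_of_mem_nhds ((ultrafilter_isOpen_basic B).mem_nhds hBF),
          ∅, empty_subset _, finite_empty, B, hB, fun G hG => Or.inr hG⟩
      · have hadm : P.Admissible F := fun B hBF hB => (hF ⟨B, hBF, hB⟩).elim
        have hmem : mk hP ⟨F, hadm⟩ ∈ ⋃₀ 𝒰 := hc ▸ mem_univ _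
        obtain ⟨U, hU, hFU⟩ := hmem
        obtain ⟨V, hV, hVU⟩ := isOpen_induced_iff.1
          ((ho U hU).preimage (isQuotientMap_mk hP).continuous)
        refine ⟨V, mem_nhdsWithin_of_mem_nhds (hV.mem_nhds ?_), {U}, singleton_subset_iff.2 hU,
          finite_singleton U, ∅, P.isBounded_empty, fun G hG => Or.inl ?_⟩
        · have : (⟨F, hadm⟩ : {F : Ultrafilter X // P.Admissible F}) ∈ Subtype.val ⁻¹' V :=
            hVU ▸ hFU
          exact this
        · rw [sUnion_singleton]
          have : G ∈ mk hP ⁻¹' U := hVU ▸ hG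
          exact this
  refine ⟨ℱ, hℱ, hfin, (largeScaleStructure hP).subset_mem _ ⟨B, hB, rfl⟩ _ fun q hq => ?_⟩
  obtain ⟨F, rfl⟩ := mk_surjective hP q
  exact (mk_mem_image_of hP hB).2 ((h F (mem_univ _)).resolve_left hq)

/-- The bounded part `C ∩ D` is already closed, and the rest `C \ D` is far from `D`, so its closure
misses that of `D`. -/
lemma closure_inter_closure_subset {C D : Set X} (h : P.orth C D) :
    closure (of hP '' C) ∩ closure (of hP '' D) ⊆ of hP '' (C ∩ D) := by
  rintro q ⟨hqC, hqD⟩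
  rw [← sdiff_union_inter C D, image_union, closure_union,
    (isClopen_image_of hP (hP.isBounded_inter h)).1.closure_eq] at hqC
  refine hqC.resolve_left fun hq => ?_
  obtain ⟨F, rfl⟩ := mk_surjective hP q
  obtain ⟨C', D', hCD, hC, hD⟩ := hP.exists_far
    (⟨disjoint_sdiff_left, orth_mono h sdiff_subset subset_rfl⟩ : P.Far (C \ D) D)
  have hF : C' ∪ D' ∈ F.1 := hCD ▸ univ_mem
  rcases Ultrafilter.union_mem_iff.1 hF with hF | hF
  · exact not_far_of_mem_closure hP hqD hF hC
  · exact not_far_of_mem_closure hP hq hF hD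

end LSCompactification

/-! ### Ultrafilters witnessing non-orthogonality. -/

/-- A proper ideal of sets is avoided by some ultrafilter. -/
lemma exists_ultrafilter_avoiding (p : Set X → Prop) (h₀ : p ∅)
    (hmono : ∀ t, p t → ∀ s ⊆ t, p s) (hunion : ∀ s, p s → ∀ t, p t → p (s ∪ t))
    (huniv : ¬ p univ) : ∃ F : Ultrafilter X, ∀ A ∈ F, ¬ p A := by
  have : (comk p h₀ hmono hunion).NeBot := by
    rw [neBot_iff, Ne, ← empty_mem_iff_bot, mem_comk, compl_empty]
    exact huniv
  refine ⟨Ultrafilter.of (comk p h₀ hmono hunion), fun A hA hp => ?_⟩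
  have : Aᶜ ∈ Ultrafilter.of (comk p h₀ hmono hunion) :=
    Ultrafilter.of_le _ (by rwa [mem_comk, compl_compl])
  exact Ultrafilter.compl_mem_iff_notMem.1 this hA

/-- Sets that are not orthogonal carry near ultrafilters without bounded members. -/
lemma exists_near_of_not_orth {C D : Set X} (h : ¬ P.orth C D) :
    ∃ F G : Ultrafilter X, C ∈ F ∧ D ∈ G ∧ P.Near F G ∧ ∀ B, P.IsBounded B → B ∉ F := by
  obtain ⟨F, hF⟩ := exists_ultrafilter_avoiding (fun A => P.orth (A ∩ C) D)
    (by simpa using P.orth_empty_left D)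
    (fun t ht s hst => orth_mono ht (inter_subset_inter_left _ hst) subset_rfl)
    (fun s hs t ht => by rw [union_inter_distrib_right]; exact P.orth_union_left hs ht)
    (by simpa using h)
  -- This ideal is proper because no member of `F` is orthogonal to `D`.
  obtain ⟨G, hG⟩ := exists_ultrafilter_avoiding (fun B => ∃ A ∈ F, P.orth A (B ∩ D))
    ⟨univ, univ_mem, by simpa using P.symm _ _ (P.orth_empty_left univ)⟩
    (fun t ⟨A, hA, ht⟩ s hst => ⟨A, hA, orth_mono_right ht (inter_subset_inter_left _ hst)⟩)
    (fun s ⟨A, hA, hs⟩ t ⟨B, hB, ht⟩ => ⟨A ∩ B, inter_mem hA hB, by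
      rw [union_inter_distrib_right]
      exact (P.union_iff _ _ _).2 ⟨orth_mono hs inter_subset_left subset_rfl,
        orth_mono ht inter_subset_right subset_rfl⟩⟩)
    (fun ⟨A, hA, h⟩ => hF A hA (orth_mono h inter_subset_left (by simp)))
  refine ⟨F, G, ?_, ?_, ?_, ?_⟩
  · by_contra hC
    exact hF _ (Ultrafilter.compl_mem_iff_notMem.2 hC) (by simpa using P.orth_empty_left D)
  · by_contra hD
    exact hG _ (Ultrafilter.compl_mem_iff_notMem.2 hD)
      ⟨univ, univ_mem, by simpa using P.symm _ _ (P.orth_empty_left univ)⟩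
  · exact fun A hA B hB hAB => hG B hB ⟨A, hA, orth_mono_right hAB.2 inter_subset_left⟩
  · exact fun B hB hBF => hF B hBF (orth_mono (hB.orth D) inter_subset_left subset_rfl)

theorem LSCompactification.isLargeScaleCompactification (hP : P.IsNormal) :
    IsLargeScaleCompactification P (largeScaleStructure hP) (of hP) where
  largeScaleCompact := isLargeScaleCompact hP
  injective := of_injective hP
  dense := denseRange_of hP
  bornology_eq := rfl
  orth_iff C D := by
    constructor
    · intro h
      have hsub := closure_inter_closure_subset hP h
      refine ⟨hsub.trans (image_subset_range _ _), (hP.isBounded_inter h).subset ?_⟩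
      exact (preimage_mono hsub).trans (preimage_image_eq _ (of_injective hP)).subset
    · rintro ⟨hr, hb⟩
      by_contra h
      obtain ⟨F, G, hC, hD, hFG, hB⟩ := exists_near_of_not_orth h
      have hF : P.Admissible F := fun B hBF h => (hB B h hBF).elim
      have hG : P.Admissible G := fun B hBG h => (hB B h (hFG.symm.bounded_mem h hBG)).elim
      have hq : mk hP ⟨F, hF⟩ ∈ closure (of hP '' C) ∩ closure (of hP '' D) := by
        refine ⟨mk_mem_closure hP hC, ?_⟩
        rw [(mk_eq_iff hP (G := ⟨G, hG⟩)).2 hFG]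
        exact mk_mem_closure hP hD
      obtain ⟨x, hx⟩ := hr hq
      refine hB _ hb ((mk_mem_image_of hP (F := ⟨F, hF⟩) hb).1 ⟨x, ?_, hx⟩)
      rwa [mem_preimage, hx]

end OrthogonalityRelation

/-- A Hausdorff large scale compact space is regular. -/
lemma LargeScaleStructure.IsLargeScaleCompact.t3Space {Y : Type v} [TopologicalSpace Y] [T2Space Y]
    {L : LargeScaleStructure Y} (hL : L.IsLargeScaleCompact) : T3Space Y := by
  have : RegularSpace Y := by
    refine RegularSpace.of_exists_mem_nhds_isClosed_subset fun y s hs => ?_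
    by_cases hy : ∃ B ∈ L.bornology, y ∈ B
    · obtain ⟨B, hB, hyB⟩ := hy
      have hcl := L.isClopen _ (L.subset_mem B hB {y} (singleton_subset_iff.2 hyB))
      exact ⟨{y}, hcl.2.mem_nhds rfl, hcl.1, singleton_subset_iff.2 (mem_of_mem_nhds hs)⟩
    · push Not at hy
      -- The family of open sets that are inside `s` or whose closure misses `y`.
      obtain ⟨ℱ, hℱ, hfin, hB⟩ := hL {U | IsOpen U ∧ (U ⊆ s ∨ y ∉ closure U)}
        (fun U hU => hU.1) (eq_univ_of_forall fun w => by
          by_cases hw : w = y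
          · exact ⟨interior s, ⟨isOpen_interior, Or.inl interior_subset⟩,
              hw ▸ mem_interior_iff_mem_nhds.2 hs⟩
          · obtain ⟨U, V, hU, hV, hwU, hyV, hd⟩ := t2_separation hw
            exact ⟨U, ⟨hU, Or.inr fun h => Set.disjoint_left.1 (hd.closure_left hV) h hyV⟩, hwU⟩)
      set K : Set Y := ⋃ U ∈ {U ∈ ℱ | y ∉ closure U}, closure U
      have hfin' : {U ∈ ℱ | y ∉ closure U}.Finite := hfin.subset (sep_subset _ _)
      have hK : IsClosed K := hfin'.isClosed_biUnion fun _ _ => isClosed_closure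
      have hyK : y ∉ K := by
        simp only [K, mem_iUnion, not_exists]
        exact fun U hU => hU.2
      have hcl := L.isClopen _ hB
      -- Any point left here is covered by `ℱ`, but only by members contained in `s`.
      refine ⟨(⋃ U ∈ {U ∈ ℱ | y ∉ closure U}, U)ᶜ ∩ ((⋃₀ ℱ)ᶜ)ᶜ, ?_, ?_, ?_⟩
      · refine mem_of_superset ((hK.isOpen_compl.inter hcl.1.isOpen_compl).mem_nhds
          ⟨hyK, hy _ hB⟩) (inter_subset_inter_left _ (compl_subset_compl.2 ?_))
        exact iUnion₂_mono fun U _ => subset_closure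
      · exact (isOpen_biUnion fun U hU => (hℱ hU.1).1).isClosed_compl.inter hcl.2.isClosed_compl
      · rintro w ⟨hw, hw'⟩
        obtain ⟨U, hU, hwU⟩ := not_not.1 hw'
        refine (hℱ hU).2.elim (fun h => h hwU) fun h => (hw ?_).elim
        exact mem_biUnion (show U ∈ {U ∈ ℱ | y ∉ closure U} from ⟨hU, h⟩) hwU
  infer_instance

/-! ### Extension of inclusions between compactifications. -/

namespace IsLargeScaleCompactification

variable {X : Type u} {P : OrthogonalityRelation X}
  {Y : Type v} [TopologicalSpace Y] {L : LargeScaleStructure Y} {ι : X → Y}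
  {Z : Type w} [TopologicalSpace Z] [T2Space Z] {M : LargeScaleStructure Z} {κ : X → Z}

lemma isClopen_image (hY : IsLargeScaleCompactification P L ι) {B : Set X} (hB : P.IsBounded B) :
    IsClopen (ι '' B) :=
  L.isClopen _ (hY.bornology_eq ▸ ⟨B, hB, rfl⟩)

/-- Bounded points are isolated. Elsewhere a cluster point exists, and it is a limit because
separation of closures in `Z` passes to `Y` through orthogonality. -/
lemma exists_tendsto (hY : IsLargeScaleCompactification P L ι)
    (hZ : IsLargeScaleCompactification P M κ) (y : Y) :
    ∃ z, Tendsto κ (comap ι (𝓝 y)) (𝓝 z) := by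
  by_cases hy : ∃ B, P.IsBounded B ∧ y ∈ ι '' B
  · obtain ⟨B, hB, x, hx, rfl⟩ := hy
    have hcl := hY.isClopen_image (hB.subset (singleton_subset_iff.2 hx))
    rw [image_singleton] at hcl
    refine ⟨κ x, (tendsto_pure_nhds κ x).mono_left ?_⟩
    rw [le_pure_iff]
    refine ⟨{ι x}, hcl.2.mem_nhds rfl, fun w hw => hY.injective hw⟩
  · push Not at hy
    have := hZ.largeScaleCompact.t3Space
    -- A cluster point exists by large scale compactness.
    obtain ⟨z, hz⟩ : ∃ z, ∀ W ∈ 𝓝 z, ∀ U ∈ 𝓝 y, ∃ x, ι x ∈ U ∧ κ x ∈ W := by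
      by_contra hne
      simp only [not_exists, not_forall, not_and] at hne
      obtain ⟨ℱ, hℱ, hfin, hB⟩ := hZ.largeScaleCompact
        {W | IsOpen W ∧ ∃ U ∈ 𝓝 y, ∀ x, ι x ∈ U → κ x ∉ W} (fun W hW => hW.1)
        (eq_univ_of_forall fun z => by
          obtain ⟨W, hW, U, hU, h⟩ := hne z
          exact ⟨interior W, ⟨isOpen_interior, U, hU, fun x hx h' => h x hx (interior_subset h')⟩,
            mem_interior_iff_mem_nhds.2 hW⟩)
      rw [hZ.bornology_eq] at hB
      obtain ⟨B, hB, hBℱ⟩ := hB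
      have hU : ∀ W ∈ ℱ, ∃ U ∈ 𝓝 y, ∀ x, ι x ∈ U → κ x ∉ W := fun W hW => (hℱ hW).2
      choose! U hU hUW using hU
      have hN : (⋂ W ∈ ℱ, U W) ∩ (ι '' B)ᶜ ∈ 𝓝 y :=
        inter_mem ((biInter_mem hfin).2 hU)
          ((hY.isClopen_image hB).1.isOpen_compl.mem_nhds (hy B hB))
      obtain ⟨x, hx, hxB⟩ := hY.dense.exists_mem_open isOpen_interior
        ⟨y, mem_interior_iff_mem_nhds.2 hN⟩ |>.imp fun x hx => interior_subset hx
      have hκ : κ x ∈ (⋃₀ ℱ)ᶜ := by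
        rintro ⟨W, hW, hxW⟩
        exact hUW W hW x (mem_iInter₂.1 hx W hW) hxW
      rw [← hBℱ] at hκ
      exact hxB (mem_image_of_mem _ ((hZ.injective.mem_set_image).1 hκ))
    refine ⟨z, fun W hW => ?_⟩
    obtain ⟨T, ⟨hT, hTcl⟩, hTW⟩ := (closed_nhds_basis z).mem_iff.1
      (interior_mem_nhds.2 hW)
    have hdisj : closure (κ '' (κ ⁻¹' T)) ∩ closure (κ '' (κ ⁻¹' (interior W))ᶜ) = ∅ := by
      have h₁ : closure (κ '' (κ ⁻¹' T)) ⊆ T := closure_minimal (image_preimage_subset _ _) hTcl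
      have h₂ : closure (κ '' (κ ⁻¹' (interior W))ᶜ) ⊆ (interior W)ᶜ :=
        closure_minimal (image_subset_iff.2 subset_rfl) isOpen_interior.isClosed_compl
      exact eq_empty_of_forall_notMem fun w hw => h₂ hw.2 (hTW (h₁ hw.1))
    have horth : P.orth (κ ⁻¹' T) (κ ⁻¹' (interior W))ᶜ := by
      rw [hZ.orth_iff, hdisj]
      exact ⟨empty_subset _, P.isBounded_empty⟩
    obtain ⟨hr, hb⟩ := (hY.orth_iff _ _).1 horth
    have hyT : y ∈ closure (ι '' (κ ⁻¹' T)) := mem_closure_iff_nhds.2 fun U hU => by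
      obtain ⟨x, hxU, hxT⟩ := hz T hT U hU
      exact ⟨ι x, hxU, x, hxT, rfl⟩
    -- The closures may meet in `Y`, but only in a bounded set, which does not contain `y`.
    have hyW : y ∉ closure (ι '' (κ ⁻¹' (interior W))ᶜ) := fun h => by
      obtain ⟨x, rfl⟩ := hr ⟨hyT, h⟩
      exact hy _ hb ⟨x, ⟨hyT, h⟩, rfl⟩
    refine ⟨_, isClosed_closure.isOpen_compl.mem_nhds hyW, fun x hx => ?_⟩
    by_contra hxW
    exact hx (subset_closure ⟨x, fun h => hxW (interior_subset (s := W) h), rfl⟩)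

lemma exists_continuous_extension (hY : IsLargeScaleCompactification P L ι)
    (hZ : IsLargeScaleCompactification P M κ) :
    ∃ g : Y → Z, Continuous g ∧ ∀ x, g (ι x) = κ x := by
  have := hZ.largeScaleCompact.t3Space
  let : TopologicalSpace X := .induced ι inferInstance
  have hι : IsDenseInducing ι := ⟨⟨rfl⟩, hY.dense⟩
  refine ⟨hι.extend κ, hι.continuous_extend (hY.exists_tendsto hZ), fun x => ?_⟩
  obtain ⟨z, hz⟩ := hY.exists_tendsto hZ (ι x)
  rw [hι.extend_eq_of_tendsto hz]
  -- The limit along this filter is also a limit along `pure x`, which forces it to be `κ x`.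
  have hx : pure x ≤ comap ι (𝓝 (ι x)) := by
    rw [← map_le_iff_le_comap, map_pure]
    exact pure_le_nhds _
  exact (pure_le_nhds_iff.1 (by simpa only [Tendsto, map_pure] using hz.mono_left hx)).symm

end IsLargeScaleCompactification

theorem corollary13p15 {X : Type u} (P : OrthogonalityRelation X) (hP : P.IsNormal) :
    (∃ (Y : Type u) (_ : TopologicalSpace Y) (L : LargeScaleStructure Y) (ι : X → Y),
        T2Space Y ∧ IsLargeScaleCompactification P L ι) ∧
      ∀ (Y : Type v) [TopologicalSpace Y] [T2Space Y] (L : LargeScaleStructure Y) (ι : X → Y)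
        (Z : Type w) [TopologicalSpace Z] [T2Space Z] (M : LargeScaleStructure Z) (κ : X → Z),
        IsLargeScaleCompactification P L ι → IsLargeScaleCompactification P M κ →
          ∃ h : Y ≃ₜ Z, ∀ x : X, h (ι x) = κ x := by
  refine ⟨⟨_, _, _, _, inferInstance,
    OrthogonalityRelation.LSCompactification.isLargeScaleCompactification hP⟩, ?_⟩
  intro Y _ _ L ι Z _ _ M κ hY hZ
  obtain ⟨g, hg, hgι⟩ := hY.exists_continuous_extension hZ
  obtain ⟨f, hf, hfκ⟩ := hZ.exists_continuous_extension hY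
  have hfg : f ∘ g = id :=
    hY.dense.equalizer (hf.comp hg) continuous_id (funext fun x => by simp [hgι, hfκ])
  have hgf : g ∘ f = id :=
    hZ.dense.equalizer (hg.comp hf) continuous_id (funext fun x => by simp [hgι, hfκ])
  exact ⟨⟨⟨g, f, congrFun hfg, congrFun hgf⟩, hg, hf⟩, hgι⟩
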